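/- Let $b\ge 2$ be an integer and let $\phi=\frac{1+\sqrt5}{2}$. A base $b$ over-expansion of a positive integer $N$ is a word $d_r d_{r-1}\cdots d_0$ over the alphabet $\{0,1,\ldots,b\}$ with $d_r\neq 0$ and $\sum_{i=0}^{r} d_i b^i=N$. Let $s_b(0)=0$, $s_b(1)=1$ and, for $n\ge 2$, let $s_b(n)$ be the number of base $b$ over-expansions of $n-1$. Let $h_1=h_2=1$ and, for $m\ge 3$, let \[h_m=1+\sum_{i=0}^{\lfloor (m-3)/2\rfloor} b^{m-2-2i}.\] For any real $x\ge 0$ and any integer $k\ge 3$, let \[\beta(x)=\log_b\bigl((b^2-1)x+1\bigr)\] and \[f_k(x)=\frac1{\sqrt5}\Bigl[(k-\beta(x))\bigl(\phi^{\beta(x)}+\phi^{-\beta(x)}\bigr)+\phi^{\beta(x)+2}+\phi^{-\beta(x)-2}\Bigr].\] If $k$ and $n$ are positive integers such that $k\ge 3$ and $b^k<n\le b^k+h_k$, then \[s_b(n)<f_k(n-b^k).\] -/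

import Mathlib

/-- The base `b` over-expansions of `N`: words over the digits `0, 1, …, b` with nonzero leading
digit and value `N`. A word is written as the list of its digits, least significant digit first,
so its leading digit is the last entry of the list. -/
def overExpansions (b N : ℕ) : Set (List ℕ) :=
  {d | (∀ a ∈ d, a ≤ b) ∧ (∀ hd : d ≠ [], d.getLast hd ≠ 0) ∧ Nat.ofDigits b d = N}

/-- For `b ≥ 2` every `N` has only finitely many over-expansions, so that counting them with
`Set.ncard` is meaningful. -/
theorem overExpansions_finite {b : ℕ} (hb : 2 ≤ b) (N : ℕ) : (overExpansions b N).Finite := by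
  induction N using Nat.strong_induction_on with
  | _ N ih =>
    rcases Nat.eq_zero_or_pos N with hN | hN
    · refine (Set.finite_singleton ([] : List ℕ)).subset ?_
      rintro d ⟨-, h2, h3⟩
      by_contra hd
      have hd' : d ≠ [] := hd
      exact h2 hd' (Nat.digits_zero_of_eq_zero (by omega : b ≠ 0) (h3.trans hN) _
        (List.getLast_mem hd'))
    · have hfin : (⋃ a ∈ Set.Iic b, ⋃ M ∈ Set.Iio N,
          (fun l : List ℕ => a :: l) '' overExpansions b M).Finite :=
        (Set.finite_Iic b).biUnion fun a _ =>
          (Set.finite_Iio N).biUnion fun M hM => (ih M hM).image _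
      refine hfin.subset ?_
      rintro d ⟨h1, h2, h3⟩
      cases d with
      | nil => simp at h3; omega
      | cons a l =>
        rw [Nat.ofDigits_cons] at h3
        simp only [Set.mem_iUnion]
        refine ⟨a, h1 a (by simp), Nat.ofDigits b l, ?_, l, ⟨fun c hc => h1 c (by simp [hc]),
          fun hl => ?_, rfl⟩, rfl⟩
        · simp only [Set.mem_Iio]
          rcases Nat.eq_zero_or_pos (Nat.ofDigits b l) with h0 | h0
          · omega
          · nlinarith
        · have := h2 (by simp)
          rwa [List.getLast_cons hl] at this

/-- The generalized Stern sequence: `s_b(0) = 0`, `s_b(1) = 1`, and for `n ≥ 2`, `s_b(n)` is the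
number of base `b` over-expansions of `n - 1`. -/
noncomputable def sternSeq (b : ℕ) : ℕ → ℕ
  | 0 => 0
  | 1 => 1
  | n + 2 => (overExpansions b (n + 1)).ncard

/-- The sequence `h_1 = h_2 = 1` and `h_m = 1 + ∑_{i=0}^{⌊(m-3)/2⌋} b^{m-2-2i}` for `m ≥ 3`
(the value at `m = 0` is irrelevant). -/
def hSeq (b m : ℕ) : ℕ :=
  if m < 3 then 1 else 1 + ∑ i ∈ Finset.range ((m - 3) / 2 + 1), b ^ (m - 2 - 2 * i)

/-- `β(x) = log_b((b² - 1) x + 1)`. -/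
noncomputable def betaFun (b : ℕ) (x : ℝ) : ℝ :=
  Real.logb (b : ℝ) (((b : ℝ) ^ 2 - 1) * x + 1)

/-- `f_k(x) = (1/√5) [(k - β(x)) (φ^{β(x)} + φ^{-β(x)}) + φ^{β(x)+2} + φ^{-β(x)-2}]`, where `φ` is
the golden ratio `(1 + √5)/2`. -/
noncomputable def fFun (b k : ℕ) (x : ℝ) : ℝ :=
  1 / Real.sqrt 5 *
    (((k : ℝ) - betaFun b x) *
        (Real.goldenRatio ^ (betaFun b x) + Real.goldenRatio ^ (-betaFun b x))
      + Real.goldenRatio ^ (betaFun b x + 2) + Real.goldenRatio ^ (-betaFun b x - 2))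

/-! Write `n = b ^ k + x` with `1 ≤ x ≤ h_k`, and put `C(z) = φ^z + φ^(-z)` (`goldenCosh`). Then `√5
f_k(x) = (k - β) C(β) + C(β + 2)` with `β = β(x)`. For `x ≤ b ^ k` the Stern sequence satisfies `s(b
^ (k+1) + x) = s(b ^ k + x) + s(x)`, so raising `k` by one adds `s(x)` on the left and `C(β)/√5` on
the right. The bound therefore passes from `k` to `k + 1` once `√5 s(x) < C(β)` is carried along;
`SternBounds` is this pair of inequalities.

It remains to start the induction at `k = M + 2` for `h_(M+1) < x ≤ h_(M+2)`, where `β` lies near `M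
+ 1` or `M + 2` and `√5 F_m` is close to `C(m)`. For `x ≤ b ^ M` the Fibonacci bound
`sternSeq_le_fib` and a tangent estimate for `C` suffice (`sternBounds_of_le_pow`). At `x = h_(M+2)`
the same tools work because `β` is `M + 2` or slightly more (`sternBounds_hSeq`). In the remaining
range `x = b ^ M + y`, `1 ≤ y < h_M`, `β` drops below `M + 2`, and the Fibonacci bound has to be
improved in proportion: `fib_sub_sternSeq_lower` bounds `F_M - s(y)` below by a multiple of `b ^ M -
((b² - 1) y + 1)`, the quantity that controls `M + 2 - β` (`sternBounds_of_lt_hSeq`). -/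

/-! ### Over-expansions and the recursion of the Stern sequence -/

theorem cons_mem_overExpansions {b N a : ℕ} {l : List ℕ} :
    a :: l ∈ overExpansions b N ↔
      a ≤ b ∧ (l = [] → a ≠ 0) ∧ ∃ M, l ∈ overExpansions b M ∧ a + b * M = N := by
  simp only [overExpansions, Set.mem_ofPred_eq, List.mem_cons, forall_eq_or_imp,
    Nat.ofDigits_cons, ne_eq, reduceCtorEq, not_false_eq_true, forall_true_left]
  rcases l with _ | ⟨c, l⟩
  · simp
  · simp [List.getLast_cons]
    tauto

theorem nil_mem_overExpansions {b N : ℕ} : [] ∈ overExpansions b N ↔ N = 0 := by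
  simp [overExpansions, eq_comm]

theorem overExpansions_zero {b : ℕ} (hb : 2 ≤ b) : overExpansions b 0 = {[]} := by
  ext d
  rcases d with _ | ⟨a, l⟩
  · simp [nil_mem_overExpansions]
  · simp only [cons_mem_overExpansions, Set.mem_singleton_iff, reduceCtorEq, iff_false]
    rintro ⟨-, h, M, hl, hM⟩
    have ha : a = 0 := by omega
    have hM0 : M = 0 := by
      rcases Nat.eq_zero_or_pos M with h0 | h0
      · exact h0
      · have := Nat.mul_pos (by omega : 0 < b) h0
        omega
    subst hM0
    rcases l with _ | ⟨c, l⟩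
    · exact h rfl ha
    · refine hl.2.1 (by simp) (Nat.digits_zero_of_eq_zero (by omega : b ≠ 0) hl.2.2 _
        (List.getLast_mem _))

theorem overExpansions_mul_add {b m j : ℕ} (hj : 1 ≤ j) (hjb : j < b) :
    overExpansions b (b * m + j) = (fun l => j :: l) '' overExpansions b m := by
  ext d
  rcases d with _ | ⟨a, l⟩
  · simp [nil_mem_overExpansions]; omega
  · simp only [cons_mem_overExpansions, Set.mem_image, List.cons.injEq]
    constructor
    · rintro ⟨ha, -, M, hl, hM⟩
      have hMm : M = m := by
        rcases lt_trichotomy M m with h | h | h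
        · nlinarith
        · exact h
        · nlinarith
      subst hMm
      exact ⟨l, hl, by omega, rfl⟩
    · rintro ⟨l', hl', rfl, rfl⟩
      exact ⟨hjb.le, fun _ => by omega, m, hl', by omega⟩

/-- A multiple of `b` has lowest digit `0` or `b`; the latter borrows one from the quotient. -/
theorem overExpansions_mul_succ {b m : ℕ} (hb : 2 ≤ b) :
    overExpansions b (b * (m + 1)) =
      (fun l => 0 :: l) '' overExpansions b (m + 1) ∪ (fun l => b :: l) '' overExpansions b m := by
  ext d
  rcases d with _ | ⟨a, l⟩
  · simp [nil_mem_overExpansions]; omega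
  · simp only [cons_mem_overExpansions, Set.mem_image, List.cons.injEq, Set.mem_union]
    constructor
    · rintro ⟨ha, -, M, hl, hM⟩
      have h1 : M ≤ m + 1 := by
        by_contra h
        have : b * (m + 2) ≤ b * M := Nat.mul_le_mul_left b (by omega)
        nlinarith
      have h2 : m ≤ M := by
        by_contra h
        have : b * (M + 1) ≤ b * m := Nat.mul_le_mul_left b (by omega)
        nlinarith
      rcases (by omega : M = m ∨ M = m + 1) with rfl | rfl
      · exact Or.inr ⟨l, hl, by nlinarith, rfl⟩
      · exact Or.inl ⟨l, hl, by omega, rfl⟩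
    · rintro (⟨l', hl', rfl, rfl⟩ | ⟨l', hl', rfl, rfl⟩)
      · refine ⟨by omega, fun h => ?_, m + 1, hl', by omega⟩
        rw [h, nil_mem_overExpansions] at hl'
        omega
      · exact ⟨le_rfl, fun _ => by omega, m, hl', by ring⟩

theorem sternSeq_succ {b : ℕ} (hb : 2 ≤ b) (N : ℕ) :
    sternSeq b (N + 1) = (overExpansions b N).ncard := by
  rcases N with _ | N
  · simp [sternSeq, overExpansions_zero hb]
  · rfl

theorem sternSeq_mul_add {b : ℕ} (hb : 2 ≤ b) (m : ℕ) {j : ℕ} (hj : 2 ≤ j) (hjb : j ≤ b) :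
    sternSeq b (b * m + j) = sternSeq b (m + 1) := by
  obtain ⟨i, rfl⟩ : ∃ i, j = i + 1 := ⟨j - 1, by omega⟩
  rw [← add_assoc, sternSeq_succ hb, sternSeq_succ hb,
    overExpansions_mul_add (by omega) (by omega),
    Set.ncard_image_of_injective _ (fun _ _ h => (List.cons.inj h).2)]

theorem sternSeq_mul_add_one {b : ℕ} (hb : 2 ≤ b) (m : ℕ) :
    sternSeq b (b * m + 1) = sternSeq b m + sternSeq b (m + 1) := by
  -- The convention `s(0) = 0` is what makes the recursion hold at `m = 0`.
  rcases m with _ | m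
  · simp [sternSeq]
  · rw [sternSeq_succ hb, sternSeq_succ hb, sternSeq_succ hb, overExpansions_mul_succ hb,
      Set.ncard_union_eq ?_ ((overExpansions_finite hb _).image _)
        ((overExpansions_finite hb _).image _),
      Set.ncard_image_of_injective _ (fun _ _ h => (List.cons.inj h).2),
      Set.ncard_image_of_injective _ (fun _ _ h => (List.cons.inj h).2), add_comm]
    rw [Set.disjoint_left]
    rintro _ ⟨l, -, rfl⟩ ⟨l', -, h⟩
    have := (List.cons.inj h).1
    omega

/-! ### Additive relations at powers of `b` and the Fibonacci bound -/

theorem exists_mul_add_digit {b : ℕ} (hb : 2 ≤ b) {x : ℕ} (hx : 1 ≤ x) :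
    ∃ m j, x = b * m + j ∧ 1 ≤ j ∧ j ≤ b := by
  refine ⟨(x - 1) / b, (x - 1) % b + 1, ?_, by omega, Nat.mod_lt _ (by omega)⟩
  have := Nat.div_add_mod (x - 1) b
  omega

theorem sternSeq_one (b : ℕ) : sternSeq b 1 = 1 := rfl

theorem sternSeq_two {b : ℕ} (hb : 2 ≤ b) : sternSeq b 2 = 1 := by
  simpa [sternSeq_one] using sternSeq_mul_add hb 0 le_rfl hb

theorem sternSeq_mul {b : ℕ} (hb : 2 ≤ b) (m : ℕ) : sternSeq b (b * m) = sternSeq b m := by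
  rcases m with _ | m
  · rfl
  · rw [mul_add, mul_one, sternSeq_mul_add hb m hb le_rfl]

theorem sternSeq_pow {b : ℕ} (hb : 2 ≤ b) (k : ℕ) : sternSeq b (b ^ k) = 1 := by
  induction k with
  | zero => rfl
  | succ k ih => rw [pow_succ', sternSeq_mul hb, ih]

theorem sternSeq_base_add_one {b : ℕ} (hb : 2 ≤ b) : sternSeq b (b + 1) = 2 := by
  simpa [sternSeq_one, sternSeq_two hb] using sternSeq_mul_add_one hb 1

theorem sternSeq_base_add_two {b : ℕ} (hb : 2 ≤ b) : sternSeq b (b + 2) = 1 := by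
  simpa [sternSeq_two hb] using sternSeq_mul_add hb 1 le_rfl hb

/-- An additive relation between three arithmetic progressions of arguments of the generalized
Stern sequence propagates when the offsets are multiplied by `b`. -/
theorem sternSeq_add_propagate {b : ℕ} (hb : 2 ≤ b) {A B C X : ℕ}
    (h : ∀ x ≤ X, sternSeq b (A + x) = sternSeq b (B + x) + sternSeq b (C + x)) :
    ∀ x ≤ b * X, sternSeq b (b * A + x) = sternSeq b (b * B + x) + sternSeq b (b * C + x) := by
  intro x hx
  rcases Nat.eq_zero_or_pos x with rfl | hx0
  · simpa [sternSeq_mul hb] using h 0 (Nat.zero_le _)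
  obtain ⟨m, j, rfl, hj, hjb⟩ := exists_mul_add_digit hb hx0
  have hm : m + 1 ≤ X := by
    by_contra hc
    have : b * X ≤ b * m := Nat.mul_le_mul_left b (by omega)
    omega
  have e : ∀ D, b * D + (b * m + j) = b * (D + m) + j := fun D => by ring
  have h1 := h m (by omega)
  have h2 := h (m + 1) hm
  simp only [e]
  rcases Nat.lt_or_ge 1 j with hj1 | hj1
  · simp only [sternSeq_mul_add hb _ hj1 hjb, add_assoc, h2]
  · obtain rfl : j = 1 := by omega
    simp only [sternSeq_mul_add_one hb, add_assoc, h1, h2]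
    ring

theorem sternSeq_pow_succ_add {b : ℕ} (hb : 2 ≤ b) (k : ℕ) :
    ∀ x ≤ b ^ k, sternSeq b (b ^ (k + 1) + x) = sternSeq b (b ^ k + x) + sternSeq b x := by
  induction k with
  | zero =>
    intro x hx
    rcases (by simp at hx; omega : x = 0 ∨ x = 1) with rfl | rfl
    · simpa [sternSeq] using sternSeq_pow hb 1
    · simp [sternSeq_base_add_one hb, sternSeq_two hb, sternSeq_one]
  | succ k ih =>
    have := sternSeq_add_propagate (A := b ^ (k + 1)) (B := b ^ k) (C := 0) (X := b ^ k) hb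
      (by simpa using ih)
    simpa [← pow_succ'] using this

theorem sternSeq_pow_succ_add_pow_add {b : ℕ} (hb : 2 ≤ b) (k : ℕ) :
    ∀ x ≤ b ^ k, sternSeq b (b ^ (k + 2) + b ^ (k + 1) + x) =
      sternSeq b (b ^ (k + 1) + x) + sternSeq b (b ^ k + x) := by
  induction k with
  | zero =>
    intro x hx
    have e : b ^ 2 + b = b * (b + 1) := by ring
    rcases (by simp at hx; omega : x = 0 ∨ x = 1) with rfl | rfl
    · simp only [zero_add, pow_one, add_zero, pow_zero]
      rw [e, sternSeq_mul hb, sternSeq_base_add_one hb]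
      have := sternSeq_pow hb 1
      simp only [pow_one] at this
      rw [this, sternSeq_one]
    · simp only [zero_add, pow_one, pow_zero]
      rw [e, sternSeq_mul_add_one hb, sternSeq_base_add_one hb, add_assoc,
        sternSeq_base_add_two hb, sternSeq_two hb]
  | succ k ih =>
    have := sternSeq_add_propagate (A := b ^ (k + 2) + b ^ (k + 1)) (B := b ^ (k + 1))
      (C := b ^ k) (X := b ^ k) hb ih
    simpa [← pow_succ', mul_add] using this

/-- In `s(bm + 1) = s(m) + s(m + 1)` with `m = bc + r`, `1 ≤ r ≤ b`, one summand equals `s(c + 1)`: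
the first if `r ≥ 2`, the second if `r = 1`. That summand sits two levels down, which gives the
Fibonacci recursion. -/
theorem sternSeq_le_fib {b : ℕ} (hb : 2 ≤ b) (j : ℕ) :
    ∀ x ≤ b ^ j, sternSeq b x ≤ Nat.fib (j + 1) := by
  induction j using Nat.strong_induction_on with
  | _ j ih =>
    intro x hx
    rcases Nat.eq_zero_or_pos x with rfl | hx0
    · simp [sternSeq]
    rcases j with _ | j
    · obtain rfl : x = 1 := by simp at hx; omega
      simp [sternSeq_one]
    obtain ⟨m, i, rfl, hi, hib⟩ := exists_mul_add_digit hb hx0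
    have hm : m + 1 ≤ b ^ j := by
      by_contra hc
      have : b * b ^ j ≤ b * m := Nat.mul_le_mul_left b (by omega)
      rw [pow_succ'] at hx
      omega
    have ih1 := ih j (by omega)
    rcases Nat.lt_or_ge 1 i with hi1 | hi1
    · rw [sternSeq_mul_add hb _ hi1 hib]
      exact (ih1 _ hm).trans (Nat.fib_mono (by omega))
    obtain rfl : i = 1 := by omega
    rw [sternSeq_mul_add_one hb]
    rcases j with _ | j
    · obtain rfl : m = 0 := by simpa using hm
      simp [sternSeq]
    have ih2 := ih j (by omega)
    rw [show j + 1 + 1 + 1 = (j + 1) + 2 by ring, Nat.fib_add_two]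
    rcases Nat.eq_zero_or_pos m with rfl | hm0
    · have := ih1 _ hm
      simp [sternSeq] at this ⊢
      omega
    obtain ⟨c, r, rfl, hr, hrb⟩ := exists_mul_add_digit hb hm0
    have hc : c + 1 ≤ b ^ j := by
      by_contra hc
      have : b * b ^ j ≤ b * c := Nat.mul_le_mul_left b (by omega)
      rw [pow_succ'] at hm
      omega
    rcases Nat.lt_or_ge 1 r with hr1 | hr1
    · have h1 := ih1 _ hm
      have h2 := ih2 _ hc
      rw [sternSeq_mul_add hb c hr1 hrb]
      omega
    · obtain rfl : r = 1 := by omega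
      have h1 := ih1 (b * c + 1) (by omega)
      have h2 := ih2 _ hc
      rw [add_assoc, sternSeq_mul_add hb c le_rfl hb]
      omega

/-! ### The sequence `h` -/

theorem hSeq_add_two (b : ℕ) {M : ℕ} (hM : 1 ≤ M) : hSeq b (M + 2) = b ^ M + hSeq b M := by
  rcases (by omega : M = 1 ∨ M = 2 ∨ 3 ≤ M) with rfl | rfl | h
  · simp [hSeq, add_comm]
  · simp [hSeq, add_comm]
  · rw [hSeq, hSeq, if_neg (by omega), if_neg (by omega),
      show (M + 2 - 3) / 2 + 1 = ((M - 3) / 2 + 1) + 1 by omega, Finset.sum_range_succ']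
    simp only [show ∀ i, M + 2 - 2 - 2 * (i + 1) = M - 2 - 2 * i by intro i; omega]
    simp
    ring

/-- The left side is `b ^ β(h_M)`, so `β(h_M)` equals `M` for even `M` and exceeds it for odd `M`.
-/
theorem hSeq_spec (b : ℕ) (M : ℕ) (hM : 1 ≤ M) :
    ((b : ℝ) ^ 2 - 1) * hSeq b M + 1 = b ^ M + (if Even M then 0 else (b : ℝ) ^ 2 - b) := by
  induction M using Nat.strong_induction_on with
  | _ M ih =>
    rcases M with _ | _ | _ | K
    · omega
    · simp [hSeq]
    · simp [hSeq]
    · have := ih (K + 1) (by omega) (by omega)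
      rw [hSeq_add_two b (by omega)]
      simp only [Nat.even_add_one, not_not] at this ⊢
      push_cast
      split_ifs at this ⊢ <;> linear_combination this

theorem hSeq_le_pow {b : ℕ} (hb : 2 ≤ b) (M : ℕ) : hSeq b (M + 1) ≤ b ^ M := by
  induction M using Nat.strong_induction_on with
  | _ M ih =>
    rcases M with _ | _ | K
    · simp [hSeq]
    · simp [hSeq]; omega
    · have := ih K (by omega)
      rw [hSeq_add_two b (by omega)]
      have h1 : b ^ K * 1 ≤ b ^ K * b := Nat.mul_le_mul_left _ (by omega)
      have h2 : b ^ (K + 1) * 2 ≤ b ^ (K + 1) * b := Nat.mul_le_mul_left _ hb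
      simp only [← pow_succ] at h1 h2
      omega

/-! ### The defect in the Fibonacci bound -/

theorem sternSeq_pow_add_le {b : ℕ} (hb : 2 ≤ b) {M : ℕ} {x : ℕ} (hx : x ≤ b ^ M) :
    sternSeq b (b ^ (M + 1) + x) ≤ Nat.fib (M + 2) + sternSeq b x := by
  rw [sternSeq_pow_succ_add hb M x hx]
  have : b ^ M + x ≤ b ^ (M + 1) := by
    have := Nat.mul_le_mul_left (b ^ M) hb
    rw [pow_succ]; omega
  have := sternSeq_le_fib hb (M + 1) _ this
  simp only [add_assoc, Nat.reduceAdd] at *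
  omega

/-- The additive relations reduce the left side to exactly `3 s(b ^ M + x) + 2 s(x)`. -/
theorem sternSeq_pow_add_pow_add_le {b : ℕ} (hb : 2 ≤ b) {M : ℕ} {x : ℕ} (hx : x ≤ b ^ M) :
    sternSeq b (b ^ (M + 3) + (b ^ (M + 1) + x)) ≤ 3 * Nat.fib (M + 2) + 2 * sternSeq b x := by
  have h1 : b ^ M + x ≤ b ^ (M + 1) := by
    have := Nat.mul_le_mul_left (b ^ M) hb
    rw [pow_succ]; omega
  have h2 : b ^ (M + 1) + x ≤ b ^ (M + 2) := by
    have := Nat.mul_le_mul_left (b ^ (M + 1)) hb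
    have h3 : b ^ M ≤ b ^ (M + 1) := Nat.pow_le_pow_right (by omega) (by omega)
    rw [pow_succ b (M + 1)]; omega
  rw [sternSeq_pow_succ_add hb (M + 2) _ h2, ← add_assoc, sternSeq_pow_succ_add_pow_add hb M x hx,
    sternSeq_pow_succ_add hb M x hx]
  have := sternSeq_le_fib hb (M + 1) _ h1
  simp only [add_assoc, Nat.reduceAdd] at *
  omega

/-- Passing from `x'` at level `M + 1` to `b ^ (M+1) + x'` at level `M + 3` does not decrease the
Fibonacci defect, while `F_(M+3) ≤ 4 F_(M+1) ≤ b² F_(M+1)`. Only `x ≤ b ^ (M+1)` needs a direct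
argument, left as `hlow` so that `κ` can depend on `b`. -/
theorem fib_sub_sternSeq_lower {b : ℕ} (hb : 2 ≤ b) {κ : ℝ} (hκ0 : 0 ≤ κ) (hκ1 : κ ≤ 1)
    (hlow : ∀ M x : ℕ, x ≤ b ^ (M + 1) →
      κ * Nat.fib (M + 3) * ((b : ℝ) ^ (M + 3) - (((b : ℝ) ^ 2 - 1) * x + 1)) ≤
        (b : ℝ) ^ (M + 3) * (Nat.fib (M + 3) - sternSeq b x))
    (M : ℕ) : ∀ x ≤ hSeq b (M + 1),
      κ * Nat.fib (M + 1) * ((b : ℝ) ^ (M + 1) - (((b : ℝ) ^ 2 - 1) * x + 1)) ≤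
        (b : ℝ) ^ (M + 1) * (Nat.fib (M + 1) - sternSeq b x) := by
  have hbR : (2 : ℝ) ≤ b := by exact_mod_cast hb
  have hsmall : ∀ j ≤ 1, ∀ x ≤ 1,
      κ * Nat.fib (j + 1) * ((b : ℝ) ^ (j + 1) - (((b : ℝ) ^ 2 - 1) * (x : ℕ) + 1)) ≤
        (b : ℝ) ^ (j + 1) * (Nat.fib (j + 1) - sternSeq b x) := by
    intro j hj x hx
    have h1 : (b : ℝ) ≤ (b : ℝ) ^ 2 := by nlinarith
    interval_cases j <;> interval_cases x <;> simp [sternSeq] <;> nlinarith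
  induction M using Nat.strong_induction_on with
  | _ M ih =>
    intro x hx
    rcases M with _ | _ | M
    · exact hsmall 0 (by omega) x (by simpa [hSeq] using hx)
    · exact hsmall 1 (by omega) x (by simpa [hSeq] using hx)
    rcases Nat.lt_or_ge (b ^ (M + 1)) x with hlt | hle
    · obtain ⟨x', rfl⟩ : ∃ x', x = b ^ (M + 1) + x' := ⟨x - b ^ (M + 1), by omega⟩
      have hx' : x' ≤ hSeq b (M + 1) := by
        rw [hSeq_add_two b (by omega)] at hx
        omega
      have hx'' := hx'.trans (hSeq_le_pow hb M)
      have h1 := ih M (by omega) x' hx'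
      have h2 : (sternSeq b (b ^ (M + 1) + x') : ℝ) ≤ Nat.fib (M + 2) + sternSeq b x' := by
        exact_mod_cast sternSeq_pow_add_le hb hx''
      have h3 : (sternSeq b x' : ℝ) ≤ Nat.fib (M + 1) := by
        exact_mod_cast sternSeq_le_fib hb M x' hx''
      have h4 : (Nat.fib (M + 3) : ℝ) = Nat.fib (M + 1) + Nat.fib (M + 2) := by
        exact_mod_cast Nat.fib_add_two (n := M + 1)
      have h5 : (Nat.fib (M + 2) : ℝ) ≤ 2 * Nat.fib (M + 1) := by
        have e := Nat.fib_add_two (n := M)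
        have : Nat.fib M ≤ Nat.fib (M + 1) := Nat.fib_mono (by omega)
        exact_mod_cast (by omega : Nat.fib (M + 2) ≤ 2 * Nat.fib (M + 1))
      have hp : (0 : ℝ) < (b : ℝ) ^ (M + 1) := by positivity
      have e1 : (b : ℝ) ^ (M + 3) = (b : ℝ) ^ (M + 1) * (b : ℝ) ^ 2 := by rw [← pow_add]
      -- The linear factor is invariant under this shift.
      have e2 : (b : ℝ) ^ (M + 3) - (((b : ℝ) ^ 2 - 1) * ((b ^ (M + 1) + x' : ℕ) : ℝ) + 1) =
          (b : ℝ) ^ (M + 1) - (((b : ℝ) ^ 2 - 1) * x' + 1) := by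
        rw [e1]; push_cast; ring
      have hb4 : (4 : ℝ) ≤ (b : ℝ) ^ 2 := by nlinarith
      show κ * Nat.fib (M + 3) * ((b : ℝ) ^ (M + 3) - _) ≤ (b : ℝ) ^ (M + 3) * (Nat.fib (M + 3) - _)
      rw [e2]
      set D := (b : ℝ) ^ (M + 1) - (((b : ℝ) ^ 2 - 1) * x' + 1) with hD
      have h6 : (b : ℝ) ^ (M + 3) * (Nat.fib (M + 1) - sternSeq b x') ≤
          (b : ℝ) ^ (M + 3) * (Nat.fib (M + 3) - sternSeq b (b ^ (M + 1) + x')) :=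
        mul_le_mul_of_nonneg_left (by linarith) (by positivity)
      refine le_trans ?_ h6
      have h7 : 0 ≤ (b : ℝ) ^ (M + 1) * (Nat.fib (M + 1) - sternSeq b x') :=
        mul_nonneg hp.le (by linarith)
      have h8 : (b : ℝ) ^ (M + 3) * (Nat.fib (M + 1) - sternSeq b x') =
          (b : ℝ) ^ 2 * ((b : ℝ) ^ (M + 1) * (Nat.fib (M + 1) - sternSeq b x')) := by
        rw [e1]; ring
      rw [h8]
      rcases le_or_gt 0 D with hD0 | hD0
      · calc κ * Nat.fib (M + 3) * D ≤ κ * (4 * Nat.fib (M + 1)) * D := by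
              gcongr
              have : (0 : ℝ) ≤ Nat.fib (M + 1) := by positivity
              linarith
          _ = 4 * (κ * Nat.fib (M + 1) * D) := by ring
          _ ≤ 4 * ((b : ℝ) ^ (M + 1) * (Nat.fib (M + 1) - sternSeq b x')) := by linarith
          _ ≤ _ := mul_le_mul_of_nonneg_right hb4 h7
      · have : κ * Nat.fib (M + 3) * D ≤ 0 :=
          mul_nonpos_of_nonneg_of_nonpos (by positivity) hD0.le
        have := mul_nonneg (by positivity : (0 : ℝ) ≤ (b : ℝ) ^ 2) h7
        linarith
    · exact hlow M x hle

theorem fib_sub_sternSeq_lower_third {b : ℕ} (hb : 2 ≤ b) (M : ℕ) {x : ℕ}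
    (hx : x ≤ hSeq b (M + 1)) :
    1 / 3 * Nat.fib (M + 1) * ((b : ℝ) ^ (M + 1) - (((b : ℝ) ^ 2 - 1) * x + 1)) ≤
        (b : ℝ) ^ (M + 1) * (Nat.fib (M + 1) - sternSeq b x) := by
  refine fib_sub_sternSeq_lower hb (by norm_num) (by norm_num) ?_ M x hx
  intro M x hx
  have hbR : (2 : ℝ) ≤ b := by exact_mod_cast hb
  have h3 : (sternSeq b x : ℝ) ≤ Nat.fib (M + 2) := by
    exact_mod_cast sternSeq_le_fib hb (M + 1) x hx
  have h4 : (Nat.fib (M + 3) : ℝ) = Nat.fib (M + 1) + Nat.fib (M + 2) := by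
    exact_mod_cast Nat.fib_add_two (n := M + 1)
  have h5 : (Nat.fib (M + 2) : ℝ) ≤ 2 * Nat.fib (M + 1) := by
    have e := Nat.fib_add_two (n := M)
    have : Nat.fib M ≤ Nat.fib (M + 1) := Nat.fib_mono (by omega)
    exact_mod_cast (by omega : Nat.fib (M + 2) ≤ 2 * Nat.fib (M + 1))
  have h6 : (0 : ℝ) ≤ ((b : ℝ) ^ 2 - 1) * x := mul_nonneg (by nlinarith) (by positivity)
  calc 1 / 3 * Nat.fib (M + 3) * ((b : ℝ) ^ (M + 3) - (((b : ℝ) ^ 2 - 1) * x + 1))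
      ≤ 1 / 3 * Nat.fib (M + 3) * (b : ℝ) ^ (M + 3) := by gcongr; linarith
    _ = (b : ℝ) ^ (M + 3) * (1 / 3 * Nat.fib (M + 3)) := by ring
    _ ≤ _ := by gcongr; linarith

/-- What is used later is `κ b²`; for `b = 2` the constant `1/3` would give only `4/3`, whereas
`11/20` gives `2.2`. -/
theorem fib_sub_sternSeq_two_lower (M : ℕ) {x : ℕ} (hx : x ≤ hSeq 2 (M + 1)) :
    11 / 20 * Nat.fib (M + 1) * ((2 : ℝ) ^ (M + 1) - (((2 : ℝ) ^ 2 - 1) * x + 1)) ≤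
        (2 : ℝ) ^ (M + 1) * (Nat.fib (M + 1) - sternSeq 2 x) := by
  have := fib_sub_sternSeq_lower (b := 2) (κ := 11 / 20) le_rfl (by norm_num) (by norm_num)
    ?_ M x hx
  · exact_mod_cast this
  clear hx x M
  intro M x hx
  push_cast
  have key : ∀ j, x ≤ 2 ^ j → (sternSeq 2 x : ℝ) ≤ Nat.fib (j + 1) := fun j hj => by
    exact_mod_cast sternSeq_le_fib le_rfl j x hj
  -- The general split needs `F_(M+4) ≤ 21/32 F_(M+5)` and `F_(M+3) ≤ 9/20 F_(M+5)`. Their analogues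
  -- fail at the two lowest levels (`F_3/F_4 = 2/3`, `F_1/F_3 = 1/2`), which are done by hand.
  rcases M with _ | _ | M
  · rcases Nat.eq_zero_or_pos x with rfl | h0
    · norm_num [sternSeq, Nat.fib_add_two]
    · have h1 : (sternSeq 2 x : ℝ) ≤ 1 :=
        (key 1 (by simpa using hx)).trans (by norm_num [Nat.fib_add_two])
      have h2 : (1 : ℝ) ≤ x := by exact_mod_cast h0
      norm_num [Nat.fib_add_two]
      linarith
  · rcases Nat.lt_or_ge 2 x with h0 | h0
    · have h1 : (sternSeq 2 x : ℝ) ≤ 2 :=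
        (key 2 (by simpa using hx)).trans (by norm_num [Nat.fib_add_two])
      have h2 : (3 : ℝ) ≤ x := by exact_mod_cast h0
      norm_num [Nat.fib_add_two]
      linarith
    · have h1 : (sternSeq 2 x : ℝ) ≤ 1 :=
        (key 1 (by simpa using h0)).trans (by norm_num [Nat.fib_add_two])
      have h2 : (0 : ℝ) ≤ x := by positivity
      norm_num [Nat.fib_add_two]
      linarith
  · have f1 : (Nat.fib (M + 5) : ℝ) = Nat.fib (M + 3) + Nat.fib (M + 4) := by
      exact_mod_cast Nat.fib_add_two (n := M + 3)
    have f2 : (Nat.fib (M + 4) : ℝ) = Nat.fib (M + 2) + Nat.fib (M + 3) := by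
      exact_mod_cast Nat.fib_add_two (n := M + 2)
    have f3 : (Nat.fib (M + 3) : ℝ) = Nat.fib (M + 1) + Nat.fib (M + 2) := by
      exact_mod_cast Nat.fib_add_two (n := M + 1)
    have f4 : (Nat.fib (M + 2) : ℝ) = Nat.fib M + Nat.fib (M + 1) := by
      exact_mod_cast Nat.fib_add_two (n := M)
    have f5 : (Nat.fib M : ℝ) ≤ Nat.fib (M + 1) := by exact_mod_cast Nat.fib_mono (by omega)
    have f6 : (0 : ℝ) ≤ Nat.fib M := by positivity
    have hp : (0 : ℝ) < 2 ^ (M + 2) := by positivity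
    have e : (2 : ℝ) ^ (M + 5) = 8 * 2 ^ (M + 2) := by ring
    have h2 : (0 : ℝ) ≤ x := by positivity
    show 11 / 20 * (Nat.fib (M + 5) : ℝ) * (2 ^ (M + 5) - _) ≤
      2 ^ (M + 5) * ((Nat.fib (M + 5) : ℝ) - _)
    rcases Nat.lt_or_ge (2 ^ (M + 2)) x with h0 | h0
    · have h1 := key (M + 3) (by simpa using hx)
      have h3 : (2 : ℝ) ^ (M + 2) ≤ x := by exact_mod_cast h0.le
      calc 11 / 20 * (Nat.fib (M + 5) : ℝ) * (2 ^ (M + 5) - ((2 ^ 2 - 1) * x + 1))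
          ≤ 11 / 20 * (Nat.fib (M + 5) : ℝ) * (5 / 8 * 2 ^ (M + 5)) := by
            gcongr; rw [e]; linarith
        _ = 2 ^ (M + 5) * (11 / 32 * Nat.fib (M + 5)) := by ring
        _ ≤ _ := by gcongr; simp only [add_assoc, Nat.reduceAdd] at h1; linarith
    · have h1 := key (M + 2) h0
      calc 11 / 20 * (Nat.fib (M + 5) : ℝ) * (2 ^ (M + 5) - ((2 ^ 2 - 1) * x + 1))
          ≤ 11 / 20 * (Nat.fib (M + 5) : ℝ) * 2 ^ (M + 5) := by
            gcongr; linarith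
        _ = 2 ^ (M + 5) * (11 / 20 * Nat.fib (M + 5)) := by ring
        _ ≤ _ := by gcongr; simp only [add_assoc, Nat.reduceAdd] at h1; linarith

/-! ### Golden ratio estimates and the function `φ^z + φ^(-z)` -/

theorem goldenRatio_gt_approx : (1.618 : ℝ) < Real.goldenRatio := by
  have : (2.236 : ℝ) < √5 := Real.lt_sqrt_of_sq_lt (by norm_num)
  unfold Real.goldenRatio
  linarith

theorem goldenRatio_lt_approx : Real.goldenRatio < (1.6181 : ℝ) := by
  have : √5 < (2.2362 : ℝ) := (Real.sqrt_lt' (by norm_num)).2 (by norm_num)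
  unfold Real.goldenRatio
  linarith

theorem log_goldenRatio_gt : (0.479 : ℝ) < Real.log Real.goldenRatio := by
  have h1 : (2 : ℝ) ^ 9 ≤ Real.goldenRatio ^ 13 :=
    le_trans (by norm_num) (pow_le_pow_left₀ (by norm_num) goldenRatio_gt_approx.le 13)
  have h2 := Real.log_le_log (by positivity) h1
  rw [Real.log_pow, Real.log_pow] at h2
  have := Real.log_two_gt_d9
  push_cast at h2
  linarith

/-- `φ ^ z + φ ^ (-z)`. -/
noncomputable def goldenCosh (z : ℝ) : ℝ := Real.goldenRatio ^ z + Real.goldenRatio ^ (-z)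

/-- Tangent line of a convex function at `B`, with `log φ` replaced by its lower bound `0.479`. -/
theorem goldenCosh_add_ge {B σ : ℝ} (hB : 0 ≤ B) (hσ : 0 ≤ σ) :
    goldenCosh B + σ * (0.479 * (Real.goldenRatio ^ B - Real.goldenRatio ^ (-B))) ≤
      goldenCosh (B + σ) := by
  have hφ := Real.goldenRatio_pos
  have h1 : 1 + σ * Real.log Real.goldenRatio ≤ Real.goldenRatio ^ σ := by
    rw [Real.rpow_def_of_pos hφ]
    have := Real.add_one_le_exp (Real.log Real.goldenRatio * σ)
    linarith
  have h2 : 1 - σ * Real.log Real.goldenRatio ≤ Real.goldenRatio ^ (-σ) := by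
    rw [Real.rpow_def_of_pos hφ]
    have := Real.add_one_le_exp (Real.log Real.goldenRatio * -σ)
    linarith
  have h3 : Real.goldenRatio ^ (-B) ≤ Real.goldenRatio ^ B :=
    Real.rpow_le_rpow_of_exponent_le Real.one_lt_goldenRatio.le (by linarith)
  have h4 : 0 < Real.goldenRatio ^ (-B) := Real.rpow_pos_of_pos hφ _
  have h5 : 0 < Real.goldenRatio ^ B := Real.rpow_pos_of_pos hφ _
  unfold goldenCosh
  rw [neg_add, Real.rpow_add hφ, Real.rpow_add hφ]
  have h6 := mul_le_mul_of_nonneg_left h1 h5.le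
  have h7 := mul_le_mul_of_nonneg_left h2 h4.le
  have h8 : 0 ≤ σ * (Real.goldenRatio ^ B - Real.goldenRatio ^ (-B)) :=
    mul_nonneg hσ (by linarith)
  have h9 := mul_le_mul_of_nonneg_left log_goldenRatio_gt.le h8
  linarith

theorem goldenCosh_lt {z w : ℝ} (hz : 0 < z) (hzw : z < w) : goldenCosh z < goldenCosh w := by
  have h := goldenCosh_add_ge hz.le (sub_pos.2 hzw).le
  have h3 : Real.goldenRatio ^ (-z) < Real.goldenRatio ^ z :=
    Real.rpow_lt_rpow_of_exponent_lt Real.one_lt_goldenRatio (by linarith)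
  have : 0 < (w - z) * (0.479 * (Real.goldenRatio ^ z - Real.goldenRatio ^ (-z))) :=
    mul_pos (by linarith) (mul_pos (by norm_num) (by linarith))
  rw [add_sub_cancel] at h
  linarith

theorem goldenConj_pow (m : ℕ) :
    Real.goldenConj ^ m = (-1) ^ m * Real.goldenRatio ^ (-(m : ℝ)) := by
  rw [Real.rpow_neg Real.goldenRatio_pos.le, Real.rpow_natCast, ← inv_pow, ← mul_pow,
    Real.inv_goldenRatio]
  ring

theorem sqrt_five_mul_fib (m : ℕ) :
    √5 * Nat.fib m = Real.goldenRatio ^ (m : ℝ) - (-1) ^ m * Real.goldenRatio ^ (-(m : ℝ)) := by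
  rw [Real.coe_fib_eq, goldenConj_pow, Real.rpow_natCast]
  field_simp

theorem sqrt_five_mul_fib_le (m : ℕ) : √5 * Nat.fib m ≤ goldenCosh m := by
  have : 0 < Real.goldenRatio ^ (-(m : ℝ)) := Real.rpow_pos_of_pos Real.goldenRatio_pos _
  rw [sqrt_five_mul_fib, goldenCosh]
  rcases neg_one_pow_eq_or ℝ m with h | h <;> rw [h] <;> linarith

theorem sqrt_five_mul_fib_lt_of_even {m : ℕ} (hm : Even m) : √5 * Nat.fib m < goldenCosh m := by
  have : 0 < Real.goldenRatio ^ (-(m : ℝ)) := Real.rpow_pos_of_pos Real.goldenRatio_pos _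
  rw [sqrt_five_mul_fib, goldenCosh, hm.neg_one_pow]
  linarith

theorem goldenRatio_rpow_nat_le (M : ℕ) (hM : 3 ≤ M) :
    0.94 * Real.goldenRatio ^ (M : ℝ) ≤ √5 * Nat.fib M := by
  have hφ := Real.goldenRatio_pos
  have h1 : Real.goldenRatio ^ (-(M : ℝ)) ≤ 0.06 * Real.goldenRatio ^ (M : ℝ) := by
    rw [Real.rpow_neg hφ.le, Real.rpow_natCast]
    have h2 : (4.2 : ℝ) ≤ Real.goldenRatio ^ M :=
      calc (4.2 : ℝ) ≤ 1.618 ^ 3 := by norm_num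
        _ ≤ Real.goldenRatio ^ 3 := pow_le_pow_left₀ (by norm_num) goldenRatio_gt_approx.le 3
        _ ≤ _ := pow_le_pow_right₀ Real.one_lt_goldenRatio.le hM
    rw [inv_le_iff_one_le_mul₀ (by positivity)]
    nlinarith
  have : 0 < Real.goldenRatio ^ (-(M : ℝ)) := Real.rpow_pos_of_pos hφ _
  rw [sqrt_five_mul_fib]
  rcases neg_one_pow_eq_or ℝ M with h | h <;> rw [h] <;> linarith

/-! ### Comparing powers of `φ` with powers of `b` -/

theorem le_rpow_of_pow_le {x z : ℝ} (hz : 0 ≤ z) (h : x ^ 10 ≤ z ^ 7) :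
    x ≤ z ^ (0.7 : ℝ) := by
  refine le_of_pow_le_pow_left₀ (n := 10) (by norm_num) (by positivity) ?_
  rw [← Real.rpow_natCast (z ^ (0.7 : ℝ)), ← Real.rpow_mul hz,
    show (0.7 : ℝ) * ((10 : ℕ) : ℝ) = ((7 : ℕ) : ℝ) by norm_num, Real.rpow_natCast]
  exact h

theorem rpow_le_of_pow_le {x z : ℝ} (hx : 0 ≤ x) (hz : 0 ≤ z) (h : z ^ 7 ≤ x ^ 10) :
    z ^ (0.7 : ℝ) ≤ x := by
  refine le_of_pow_le_pow_left₀ (n := 10) (by norm_num) hx ?_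
  rw [← Real.rpow_natCast (z ^ (0.7 : ℝ)), ← Real.rpow_mul hz,
    show (0.7 : ℝ) * ((10 : ℕ) : ℝ) = ((7 : ℕ) : ℝ) by norm_num, Real.rpow_natCast]
  exact h

theorem goldenRatio_le_rpow {b : ℝ} (hb : 2 ≤ b) : Real.goldenRatio ≤ b ^ (0.7 : ℝ) := by
  refine le_rpow_of_pow_le (by linarith) ?_
  calc Real.goldenRatio ^ 10 ≤ 1.6181 ^ 10 :=
        pow_le_pow_left₀ Real.goldenRatio_pos.le goldenRatio_lt_approx.le 10
    _ ≤ 2 ^ 7 := by norm_num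
    _ ≤ b ^ 7 := pow_le_pow_left₀ (by norm_num) hb 7

/-- From `φ ≤ b^0.7` one gets `φ^(-τ) ≥ (1 - u)^0.7`, and concavity puts this above its chord on
`[0, 1/4]`; the slope `3/4` comes from `(3/4)^0.7 ≥ 13/16`. -/
theorem goldenRatio_rpow_neg_ge {b τ u : ℝ} (hb : 2 ≤ b) (hτ : 0 ≤ τ) (hu0 : 0 ≤ u)
    (hu : u ≤ 1 / 4) (h : b ^ (-τ) = 1 - u) : 1 - 3 / 4 * u ≤ Real.goldenRatio ^ (-τ) := by
  have hφ := Real.goldenRatio_pos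
  have h1 := goldenRatio_le_rpow hb
  have h2 : (1 - u) ^ (0.7 : ℝ) ≤ Real.goldenRatio ^ (-τ) := by
    rw [← h, ← Real.rpow_mul (by linarith), mul_comm, Real.rpow_mul (by linarith)]
    exact Real.rpow_le_rpow_of_nonpos hφ h1 (by linarith)
  have h3 : (13 / 16 : ℝ) ≤ (3 / 4 : ℝ) ^ (0.7 : ℝ) :=
    le_rpow_of_pow_le (by norm_num) (by norm_num)
  have h4 := (Real.concaveOn_rpow (p := 0.7) (by norm_num) (by norm_num)).2
    (Set.mem_Ici.2 zero_le_one) (Set.mem_Ici.2 (by norm_num : (0 : ℝ) ≤ 3 / 4))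
    (by linarith : 0 ≤ 1 - 4 * u) (by linarith : 0 ≤ 4 * u) (by ring)
  simp only [Real.one_rpow, smul_eq_mul] at h4
  rw [show (1 - 4 * u) * 1 + 4 * u * (3 / 4) = 1 - u by ring] at h4
  nlinarith

/-- Lowering the exponent by `τ` costs at most a fraction `3u/4` of the main term, and the defect
`L` pays for it. -/
theorem goldenCosh_gt_of_defect {b τ u K L : ℝ} {M : ℕ} (hb : 2 ≤ b) (hM : 3 ≤ M) (hτ : 0 < τ)
    (hu0 : 0 < u) (hu : u ≤ 1 / 4) (h : b ^ (-τ) = 1 - u)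
    (hK : (2.2 ≤ K ∧ u ≤ τ) ∨ 3 ≤ K) (hL : K * Nat.fib M * u ≤ L) :
    √5 * (Nat.fib (M + 2) - L) < goldenCosh ((M + 2 : ℕ) - τ) ∧
      √5 * (Nat.fib (M + 4) - 2 * L) <
        τ * goldenCosh ((M + 2 : ℕ) - τ) + goldenCosh ((M + 2 : ℕ) - τ + 2) := by
  have hφ := Real.goldenRatio_pos
  have hφ2 := Real.goldenRatio_sq
  have hφl := goldenRatio_gt_approx
  have hφu := goldenRatio_lt_approx
  have hw := goldenRatio_rpow_neg_ge hb hτ.le hu0.le hu h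
  have hF := goldenRatio_rpow_nat_le M hM
  have f1 := sqrt_five_mul_fib_le (M + 2)
  have f2 := sqrt_five_mul_fib_le (M + 4)
  set w := Real.goldenRatio ^ (-τ) with hwdef
  set p := Real.goldenRatio ^ (M : ℝ) with hpdef
  have hp : 0 < p := Real.rpow_pos_of_pos hφ _
  have s5 : 0 < √(5 : ℝ) := by positivity
  have r2 : Real.goldenRatio ^ ((M + 2 : ℕ) : ℝ) = p * Real.goldenRatio ^ 2 := by
    push_cast; rw [Real.rpow_add hφ, Real.rpow_two]
  have r4 : Real.goldenRatio ^ ((M + 4 : ℕ) : ℝ) = p * Real.goldenRatio ^ 2 * Real.goldenRatio ^ 2 := by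
    push_cast
    rw [show (M : ℝ) + 4 = M + 2 + 2 by ring, Real.rpow_add hφ, Real.rpow_add hφ, Real.rpow_two]
  have c1 : p * Real.goldenRatio ^ 2 * w + Real.goldenRatio ^ (-((M + 2 : ℕ) : ℝ)) ≤
      goldenCosh ((M + 2 : ℕ) - τ) := by
    unfold goldenCosh
    rw [sub_eq_add_neg, Real.rpow_add hφ, r2]
    gcongr
    · exact Real.one_lt_goldenRatio.le
    · linarith
  have c2 : p * Real.goldenRatio ^ 2 * Real.goldenRatio ^ 2 * w +
      Real.goldenRatio ^ (-((M + 4 : ℕ) : ℝ)) ≤ goldenCosh ((M + 2 : ℕ) - τ + 2) := by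
    unfold goldenCosh
    rw [show ((M + 2 : ℕ) : ℝ) - τ + 2 = (M + 4 : ℕ) + -τ by push_cast; ring,
      Real.rpow_add hφ, r4]
    gcongr
    · exact Real.one_lt_goldenRatio.le
    · linarith
  have hq : 0 < Real.goldenRatio ^ (-((M + 2 : ℕ) : ℝ)) := Real.rpow_pos_of_pos hφ _
  unfold goldenCosh at f1 f2
  rw [r2] at f1
  rw [r4] at f2
  have hK0 : 2.2 ≤ K := by rcases hK with ⟨h, -⟩ | h <;> linarith
  have hL' : 0.94 * K * u * p ≤ √5 * L := by
    have h1 : K * u * (0.94 * p) ≤ K * u * (√5 * Nat.fib M) := by gcongr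
    have h2 := mul_le_mul_of_nonneg_left hL s5.le
    linarith
  have hup : 0 < u * p := mul_pos hu0 hp
  constructor
  · have h1 : p * Real.goldenRatio ^ 2 * (1 - 3 / 4 * u) ≤ p * Real.goldenRatio ^ 2 * w := by gcongr
    have h2 : Real.goldenRatio ^ 2 * (u * p) ≤ 2.62 * (u * p) := by gcongr; linarith
    have h3 : 2.2 * (u * p) ≤ K * (u * p) := by gcongr
    linarith
  · have h1 : p * Real.goldenRatio ^ 2 * ((1 - 3 / 4 * u) * (Real.goldenRatio ^ 2 + τ)) ≤
        p * Real.goldenRatio ^ 2 * (w * (Real.goldenRatio ^ 2 + τ)) := by gcongr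
    have h2 : τ * (p * Real.goldenRatio ^ 2 * w + Real.goldenRatio ^ (-((M + 2 : ℕ) : ℝ))) ≤
        τ * goldenCosh ((M + 2 : ℕ) - τ) := by gcongr
    have h3 : 0 < τ * Real.goldenRatio ^ (-((M + 2 : ℕ) : ℝ)) := mul_pos hτ hq
    -- Here `1.88 = 2 * 0.94`. Discarding `τ` leaves about `5.15 u`, which `K ≥ 3` covers but `K =
    -- 2.2` does not; in that case `τ ≥ u` lowers the cost to about `3.15 u`.
    have h4 : Real.goldenRatio ^ 2 *
        (Real.goldenRatio ^ 2 - (1 - 3 / 4 * u) * (Real.goldenRatio ^ 2 + τ)) < 1.88 * K * u := by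
      rw [hφ2]
      rcases hK with ⟨h, h'⟩ | h
      · have h5 : (1 - 3 / 4 * u) * u ≤ (1 - 3 / 4 * u) * τ := by gcongr; linarith
        have h6 : 2.2 * u ≤ K * u := by gcongr
        have h7 : u * u ≤ 1 / 4 * u := by gcongr
        have h8 : Real.goldenRatio + 1 - (1 - 3 / 4 * u) * (Real.goldenRatio + 1 + τ) ≤ 1.2 * u := by
          have := mul_le_mul_of_nonneg_right hφu.le hu0.le
          linarith
        calc _ ≤ (Real.goldenRatio + 1) * (1.2 * u) := by gcongr
          _ ≤ 2.62 * (1.2 * u) := by gcongr; linarith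
          _ < _ := by linarith
      · have h6 : 3 * u ≤ K * u := by gcongr
        have h8 : Real.goldenRatio + 1 - (1 - 3 / 4 * u) * (Real.goldenRatio + 1 + τ) ≤
            1.965 * u := by
          have := mul_le_mul_of_nonneg_right hφu.le hu0.le
          have : 0 ≤ (1 - 3 / 4 * u) * τ := mul_nonneg (by linarith) hτ.le
          linarith
        calc _ ≤ (Real.goldenRatio + 1) * (1.965 * u) := by gcongr
          _ ≤ 2.62 * (1.965 * u) := by gcongr; linarith
          _ < _ := by linarith
    have h5 := mul_lt_mul_of_pos_left h4 hp
    linarith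

/-! ### Bounds in terms of `β` -/

theorem sqrt_five_mul_fFun (b k : ℕ) (x : ℝ) :
    √5 * fFun b k x = (k - betaFun b x) * goldenCosh (betaFun b x) +
      goldenCosh (betaFun b x + 2) := by
  unfold fFun goldenCosh
  rw [show -(betaFun b x + 2) = -betaFun b x - 2 by ring]
  field_simp
  ring

theorem base_rpow_betaFun {b : ℕ} (hb : 2 ≤ b) {x : ℝ} (hx : 0 ≤ x) :
    (b : ℝ) ^ betaFun b x = ((b : ℝ) ^ 2 - 1) * x + 1 := by
  have hbR : (2 : ℝ) ≤ b := by exact_mod_cast hb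
  have : 0 ≤ ((b : ℝ) ^ 2 - 1) * x := mul_nonneg (by nlinarith) hx
  exact Real.rpow_logb (by linarith) (by linarith) (by linarith)

/-- The upper bounds for `s_b(x)` and `s_b(b^m + x)` in terms of `β(x)`. -/
def SternBounds (b m x : ℕ) : Prop :=
  √5 * sternSeq b x < goldenCosh (betaFun b x) ∧
    √5 * sternSeq b (b ^ m + x) < (m - betaFun b x) * goldenCosh (betaFun b x) +
      goldenCosh (betaFun b x + 2)

theorem pow_add_le_pow_succ {b : ℕ} (hb : 2 ≤ b) {m x : ℕ} (hx : x ≤ b ^ m) :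
    b ^ m + x ≤ b ^ (m + 1) := by
  have := Nat.mul_le_mul_left (b ^ m) hb
  rw [pow_succ]; omega

/-- Here `β = M + 1 + σ` with `0 < σ ≤ 1`. The loss `σ C(M + 1)` in the first term is outweighed by
the tangent growth of `C` from `M + 3`, since `φ² log φ > 1`. -/
theorem sternBounds_of_le_pow {b : ℕ} (hb : 2 ≤ b) {M x : ℕ} (hM : 1 ≤ M)
    (hx : hSeq b (M + 1) < x) (hxM : x ≤ b ^ M) : SternBounds b (M + 2) x := by
  have hbR : (2 : ℝ) ≤ b := by exact_mod_cast hb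
  have hφ := Real.goldenRatio_pos
  have hφ2 := Real.goldenRatio_sq
  have hφl := goldenRatio_gt_approx
  have hy := base_rpow_betaFun hb (Nat.cast_nonneg (α := ℝ) x)
  unfold SternBounds
  set β := betaFun b x with hβ
  have hβ1 : ((M + 1 : ℕ) : ℝ) < β := by
    rw [← Real.rpow_lt_rpow_left_iff (by linarith : (1 : ℝ) < b), hy, Real.rpow_natCast]
    have h1 := hSeq_spec b (M + 1) (by omega)
    have h2 : (hSeq b (M + 1) : ℝ) < x := by exact_mod_cast hx
    have h3 : ((b : ℝ) ^ 2 - 1) * hSeq b (M + 1) < ((b : ℝ) ^ 2 - 1) * x :=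
      mul_lt_mul_of_pos_left h2 (by nlinarith)
    have h4 : (0 : ℝ) ≤ if Even (M + 1) then 0 else (b : ℝ) ^ 2 - b := by
      split_ifs <;> nlinarith
    linarith
  have hβ2 : β ≤ ((M + 2 : ℕ) : ℝ) := by
    rw [← Real.rpow_le_rpow_left_iff (by linarith : (1 : ℝ) < b), hy, Real.rpow_natCast]
    have h2 : (x : ℝ) ≤ (b : ℝ) ^ M := by exact_mod_cast hxM
    have h3 : ((b : ℝ) ^ 2 - 1) * x ≤ ((b : ℝ) ^ 2 - 1) * (b : ℝ) ^ M :=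
      mul_le_mul_of_nonneg_left h2 (by nlinarith)
    have h4 : (1 : ℝ) ≤ (b : ℝ) ^ M := one_le_pow₀ (by linarith)
    rw [pow_add]
    linarith
  have hs : (sternSeq b x : ℝ) ≤ Nat.fib (M + 1) := by
    exact_mod_cast sternSeq_le_fib hb M x hxM
  have hxM' : x ≤ b ^ (M + 1) := hxM.trans (Nat.pow_le_pow_right (by omega) (by omega))
  have ht : (sternSeq b (b ^ (M + 2) + x) : ℝ) ≤ Nat.fib (M + 3) + Nat.fib (M + 1) := by
    rw [sternSeq_pow_succ_add hb (M + 1) x hxM']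
    have := sternSeq_le_fib hb (M + 2) _ (pow_add_le_pow_succ hb hxM')
    push_cast
    have : (sternSeq b (b ^ (M + 1) + x) : ℝ) ≤ Nat.fib (M + 3) := by exact_mod_cast this
    linarith
  have hP : goldenCosh ((M + 1 : ℕ) : ℝ) < goldenCosh β :=
    goldenCosh_lt (by positivity) hβ1
  have s5 : 0 ≤ √(5 : ℝ) := by positivity
  have f1 := sqrt_five_mul_fib_le (M + 1)
  have f2 := sqrt_five_mul_fib_le (M + 3)
  have hs' := mul_le_mul_of_nonneg_left hs s5
  have ht' := mul_le_mul_of_nonneg_left ht s5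
  refine ⟨by linarith, ?_⟩
  obtain ⟨σ, hσ⟩ : ∃ σ, β = ((M + 1 : ℕ) : ℝ) + σ := ⟨β - ((M + 1 : ℕ) : ℝ), by ring⟩
  have e0 : ((M + 2 : ℕ) : ℝ) = ((M + 1 : ℕ) : ℝ) + 1 := by push_cast; ring
  have e1 : ((M + 3 : ℕ) : ℝ) = ((M + 1 : ℕ) : ℝ) + 2 := by push_cast; ring
  have hσ0 : 0 < σ := by linarith
  have hσ1 : σ ≤ 1 := by linarith
  have tan := goldenCosh_add_ge (B := ((M + 3 : ℕ) : ℝ)) (by positivity) hσ0.le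
  have e2 : β + 2 = ((M + 3 : ℕ) : ℝ) + σ := by rw [hσ, e1]; ring
  have key : goldenCosh ((M + 1 : ℕ) : ℝ) <
      0.479 * (Real.goldenRatio ^ ((M + 3 : ℕ) : ℝ) - Real.goldenRatio ^ (-((M + 3 : ℕ) : ℝ))) := by
    have g1 : Real.goldenRatio ^ ((M + 3 : ℕ) : ℝ) =
        Real.goldenRatio ^ ((M + 1 : ℕ) : ℝ) * (Real.goldenRatio + 1) := by
      rw [e1, Real.rpow_add hφ, Real.rpow_two, hφ2]
    have g2 : Real.goldenRatio ^ (-((M + 3 : ℕ) : ℝ)) ≤ Real.goldenRatio ^ (-((M + 1 : ℕ) : ℝ)) :=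
      Real.rpow_le_rpow_of_exponent_le Real.one_lt_goldenRatio.le (by linarith)
    have g3 : (2.61 : ℝ) ≤ Real.goldenRatio ^ ((M + 1 : ℕ) : ℝ) := by
      rw [Real.rpow_natCast]
      calc (2.61 : ℝ) ≤ Real.goldenRatio ^ 2 := by linarith
        _ ≤ _ := pow_le_pow_right₀ Real.one_lt_goldenRatio.le (by omega)
    have g4 : Real.goldenRatio ^ ((M + 1 : ℕ) : ℝ) * Real.goldenRatio ^ (-((M + 1 : ℕ) : ℝ)) = 1 := by
      rw [← Real.rpow_add hφ, add_neg_cancel, Real.rpow_zero]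
    unfold goldenCosh
    rw [g1]
    set q := Real.goldenRatio ^ ((M + 1 : ℕ) : ℝ)
    set r := Real.goldenRatio ^ (-((M + 1 : ℕ) : ℝ))
    have g5 : q * 2.618 ≤ q * (Real.goldenRatio + 1) := by gcongr; linarith
    have g6 : r ≤ 0.15 * q := by
      have : 0 < r := Real.rpow_pos_of_pos hφ _
      nlinarith
    linarith
  have h1 := mul_le_mul_of_nonneg_left hP.le (by linarith : 0 ≤ 1 - σ)
  have h2 := mul_lt_mul_of_pos_left key hσ0
  rw [e2, show ((M + 2 : ℕ) : ℝ) - β = 1 - σ by rw [e0, hσ]; ring]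
  linarith

theorem sternBounds_hSeq {b : ℕ} (hb : 2 ≤ b) {M : ℕ} (hM : 1 ≤ M) :
    SternBounds b (M + 2) (hSeq b (M + 2)) := by
  have hbR : (2 : ℝ) ≤ b := by exact_mod_cast hb
  have hφ := Real.goldenRatio_pos
  have hφ2 := Real.goldenRatio_sq
  have hφl := goldenRatio_gt_approx
  have hy := base_rpow_betaFun hb (Nat.cast_nonneg (α := ℝ) (hSeq b (M + 2)))
  rw [hSeq_spec b (M + 2) (by omega)] at hy
  have hh := hSeq_le_pow hb (M + 1)
  have hs : (sternSeq b (hSeq b (M + 2)) : ℝ) ≤ Nat.fib (M + 2) := by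
    exact_mod_cast sternSeq_le_fib hb (M + 1) _ hh
  have ht : (sternSeq b (b ^ (M + 2) + hSeq b (M + 2)) : ℝ) ≤ Nat.fib (M + 4) := by
    exact_mod_cast sternSeq_le_fib hb (M + 3) _ (pow_add_le_pow_succ hb
      (hh.trans (Nat.pow_le_pow_right (by omega) (by omega))))
  unfold SternBounds
  set β := betaFun b (hSeq b (M + 2)) with hβ
  have s5 : 0 ≤ √(5 : ℝ) := by positivity
  have hs' := mul_le_mul_of_nonneg_left hs s5
  have ht' := mul_le_mul_of_nonneg_left ht s5
  have e2 : ((M + 4 : ℕ) : ℝ) = ((M + 2 : ℕ) : ℝ) + 2 := by push_cast; ring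
  -- Even index: `β = M + 2` and strictness comes from Binet's formula. Odd index: `√5 F_(M+2) = C(M
  -- + 2)`, so strictness must come from `β > M + 2`.
  by_cases hev : Even (M + 2)
  · rw [if_pos hev, add_zero, ← Real.rpow_natCast,
      Real.rpow_right_inj (by linarith) (by linarith)] at hy
    have f1 := sqrt_five_mul_fib_lt_of_even hev
    have f2 := sqrt_five_mul_fib_lt_of_even (m := M + 4) (by
      obtain ⟨c, hc⟩ := hev
      exact ⟨c + 1, by omega⟩)
    rw [e2] at f2
    rw [hy]
    constructor <;> linarith
  · rw [if_neg hev] at hy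
    have hβ1 : ((M + 2 : ℕ) : ℝ) < β := by
      rw [← Real.rpow_lt_rpow_left_iff (by linarith : (1 : ℝ) < b), hy, Real.rpow_natCast]
      nlinarith
    obtain ⟨ε, hε⟩ : ∃ ε, β = ((M + 2 : ℕ) : ℝ) + ε := ⟨β - ((M + 2 : ℕ) : ℝ), by ring⟩
    have hε0 : 0 < ε := by linarith
    -- The excess `(b² - b)/b ^ (M+2)` is at most `1/4` because `b (b - 2)² ≥ 0`.
    have hbε : (b : ℝ) ^ ε ≤ 1.25 := by
      rw [hε, Real.rpow_add (by linarith), Real.rpow_natCast] at hy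
      have h3 : (b : ℝ) ^ 3 ≤ (b : ℝ) ^ (M + 2) := pow_le_pow_right₀ (by linarith) (by omega)
      have h4 : 4 * ((b : ℝ) ^ 2 - b) ≤ (b : ℝ) ^ 3 := by
        nlinarith [mul_nonneg (by linarith : (0 : ℝ) ≤ b) (sq_nonneg ((b : ℝ) - 2))]
      have h5 : (0 : ℝ) < (b : ℝ) ^ (M + 2) := by positivity
      nlinarith
    have hφε : Real.goldenRatio ^ ε ≤ 1.17 := by
      calc Real.goldenRatio ^ ε ≤ ((b : ℝ) ^ (0.7 : ℝ)) ^ ε :=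
            Real.rpow_le_rpow hφ.le (goldenRatio_le_rpow hbR) hε0.le
        _ = ((b : ℝ) ^ ε) ^ (0.7 : ℝ) := by
            rw [← Real.rpow_mul (by linarith), ← Real.rpow_mul (by linarith), mul_comm]
        _ ≤ 1.25 ^ (0.7 : ℝ) := Real.rpow_le_rpow (by positivity) hbε (by norm_num)
        _ ≤ 1.17 := rpow_le_of_pow_le (by norm_num) (by norm_num) (by norm_num)
    have f1 := sqrt_five_mul_fib_le (M + 2)
    have f2 := sqrt_five_mul_fib_le (M + 4)
    have hP : goldenCosh ((M + 2 : ℕ) : ℝ) < goldenCosh β := goldenCosh_lt (by positivity) hβ1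
    refine ⟨by linarith, ?_⟩
    have tan := goldenCosh_add_ge (B := ((M + 4 : ℕ) : ℝ)) (by positivity) hε0.le
    have key : goldenCosh β <
        0.479 * (Real.goldenRatio ^ ((M + 4 : ℕ) : ℝ) -
          Real.goldenRatio ^ (-((M + 4 : ℕ) : ℝ))) := by
      have g1 : Real.goldenRatio ^ ((M + 4 : ℕ) : ℝ) =
          Real.goldenRatio ^ ((M + 2 : ℕ) : ℝ) * (Real.goldenRatio + 1) := by
        rw [e2, Real.rpow_add hφ, Real.rpow_two, hφ2]
      have g2 : Real.goldenRatio ^ (-((M + 4 : ℕ) : ℝ)) ≤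
          0.382 * Real.goldenRatio ^ (-((M + 2 : ℕ) : ℝ)) := by
        rw [e2, neg_add, Real.rpow_add hφ, mul_comm, Real.rpow_neg hφ.le 2, Real.rpow_two, hφ2]
        gcongr
        rw [inv_le_iff_one_le_mul₀ (by linarith)]
        linarith
      have g3 : (4.23 : ℝ) ≤ Real.goldenRatio ^ ((M + 2 : ℕ) : ℝ) := by
        rw [Real.rpow_natCast]
        calc (4.23 : ℝ) ≤ 1.618 ^ 3 := by norm_num
          _ ≤ Real.goldenRatio ^ 3 := pow_le_pow_left₀ (by norm_num) hφl.le 3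
          _ ≤ _ := pow_le_pow_right₀ Real.one_lt_goldenRatio.le (by omega)
      have g4 : Real.goldenRatio ^ ((M + 2 : ℕ) : ℝ) *
          Real.goldenRatio ^ (-((M + 2 : ℕ) : ℝ)) = 1 := by
        rw [← Real.rpow_add hφ, add_neg_cancel, Real.rpow_zero]
      have g7 : Real.goldenRatio ^ (-β) ≤ Real.goldenRatio ^ (-((M + 2 : ℕ) : ℝ)) :=
        Real.rpow_le_rpow_of_exponent_le Real.one_lt_goldenRatio.le (by linarith)
      unfold goldenCosh
      rw [g1]
      nth_rw 1 [hε]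
      rw [Real.rpow_add hφ]
      set q := Real.goldenRatio ^ ((M + 2 : ℕ) : ℝ)
      set r := Real.goldenRatio ^ (-((M + 2 : ℕ) : ℝ))
      have g5 : q * 2.618 ≤ q * (Real.goldenRatio + 1) := by gcongr; linarith
      have g8 : q * Real.goldenRatio ^ ε ≤ q * 1.17 := by gcongr
      have g6 : r ≤ 0.06 * q := by
        have : 0 < r := Real.rpow_pos_of_pos hφ _
        nlinarith
      linarith
    have h2 := mul_lt_mul_of_pos_left key hε0
    rw [show β + 2 = ((M + 4 : ℕ) : ℝ) + ε by rw [e2, hε]; ring,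
      show ((M + 2 : ℕ) : ℝ) - β = -ε by rw [hε]; ring]
    linarith

/-- With `β = M + 3 - τ` and `b^(-τ) = 1 - u`, the number `u b ^ (M+3)` is the linear factor `D` of
the defect bound, so the defect is at least `κ b² F_(M+1) u`. -/
theorem sternBounds_of_lt_hSeq {b : ℕ} (hb : 2 ≤ b) {M x : ℕ} (hM : 2 ≤ M) (hx1 : 1 ≤ x)
    (hx : x < hSeq b (M + 1)) : SternBounds b (M + 3) (b ^ (M + 1) + x) := by
  have hbR : (2 : ℝ) ≤ b := by exact_mod_cast hb
  have hxM := hx.le.trans (hSeq_le_pow hb M)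
  have hs : (sternSeq b (b ^ (M + 1) + x) : ℝ) ≤ Nat.fib (M + 2) + sternSeq b x := by
    exact_mod_cast sternSeq_pow_add_le hb hxM
  have ht : (sternSeq b (b ^ (M + 3) + (b ^ (M + 1) + x)) : ℝ) ≤
      3 * Nat.fib (M + 2) + 2 * sternSeq b x := by
    exact_mod_cast sternSeq_pow_add_pow_add_le hb hxM
  have f1 : (Nat.fib (M + 3) : ℝ) = Nat.fib (M + 1) + Nat.fib (M + 2) := by
    exact_mod_cast Nat.fib_add_two (n := M + 1)
  have f2 : (Nat.fib (M + 4) : ℝ) = Nat.fib (M + 2) + Nat.fib (M + 3) := by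
    exact_mod_cast Nat.fib_add_two (n := M + 2)
  have f3 : (Nat.fib (M + 5) : ℝ) = Nat.fib (M + 3) + Nat.fib (M + 4) := by
    exact_mod_cast Nat.fib_add_two (n := M + 3)
  have hy := base_rpow_betaFun hb (Nat.cast_nonneg (α := ℝ) (b ^ (M + 1) + x))
  have hp : (0 : ℝ) < (b : ℝ) ^ (M + 1) := by positivity
  have e3 : (b : ℝ) ^ (M + 3) = (b : ℝ) ^ (M + 1) * (b : ℝ) ^ 2 := by rw [← pow_add]
  set D := (b : ℝ) ^ (M + 1) - (((b : ℝ) ^ 2 - 1) * x + 1) with hD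
  -- Integrality gives `x + 1 ≤ h_(M+1)`; the gained `b² - 1` beats the odd-index excess `b² - b`.
  have hD0 : 0 < D := by
    have h1 := hSeq_spec b (M + 1) (by omega)
    have h2 : (x : ℝ) + 1 ≤ hSeq b (M + 1) := by exact_mod_cast hx
    have h3 : ((b : ℝ) ^ 2 - 1) * (x + 1) ≤ ((b : ℝ) ^ 2 - 1) * hSeq b (M + 1) :=
      mul_le_mul_of_nonneg_left h2 (by nlinarith)
    have h4 : (if Even (M + 1) then 0 else (b : ℝ) ^ 2 - b) ≤ (b : ℝ) ^ 2 - b := by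
      split_ifs <;> nlinarith
    linarith
  obtain ⟨u, hu⟩ : ∃ u, u = D / (b : ℝ) ^ (M + 3) := ⟨_, rfl⟩
  have hDu : D = u * ((b : ℝ) ^ (M + 1) * (b : ℝ) ^ 2) := by rw [hu, ← e3]; field_simp
  have hu0 : 0 < u := by rw [hu]; positivity
  have hu4 : u ≤ 1 / 4 := by
    have h1 : D ≤ (b : ℝ) ^ (M + 1) := by
      have : 0 ≤ ((b : ℝ) ^ 2 - 1) * x := mul_nonneg (by nlinarith) (by positivity)
      linarith
    have h2 : (4 : ℝ) ≤ (b : ℝ) ^ 2 := by nlinarith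
    rw [hu, e3, div_le_iff₀ (by positivity)]
    nlinarith
  unfold SternBounds
  set β := betaFun b ((b ^ (M + 1) + x : ℕ) : ℝ) with hβ
  obtain ⟨τ, hτ⟩ : ∃ τ, β = ((M + 3 : ℕ) : ℝ) - τ := ⟨((M + 3 : ℕ) : ℝ) - β, by ring⟩
  have hbτ : (b : ℝ) ^ (-τ) = 1 - u := by
    rw [hτ, sub_eq_add_neg, Real.rpow_add (by linarith), Real.rpow_natCast, e3] at hy
    have : (b : ℝ) ^ (M + 1) * (b : ℝ) ^ 2 * (b : ℝ) ^ (-τ) =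
        (b : ℝ) ^ (M + 1) * (b : ℝ) ^ 2 * (1 - u) := by
      rw [hy]; push_cast; linear_combination hD - hDu
    exact mul_left_cancel₀ (by positivity) this
  have hτ0 : 0 < τ := by
    have h1 : (b : ℝ) ^ (-τ) < (b : ℝ) ^ (0 : ℝ) := by rw [hbτ, Real.rpow_zero]; linarith
    rw [Real.rpow_lt_rpow_left_iff (by linarith)] at h1
    linarith
  have defect : ∀ κ : ℝ, κ * Nat.fib (M + 1) * D ≤
      (b : ℝ) ^ (M + 1) * (Nat.fib (M + 1) - sternSeq b x) →
      κ * (b : ℝ) ^ 2 * Nat.fib (M + 1) * u ≤ Nat.fib (M + 1) - sternSeq b x := by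
    intro κ hκ
    rw [hDu] at hκ
    refine le_of_mul_le_mul_left ?_ hp
    linarith
  have hKL : ∃ K : ℝ, ((2.2 ≤ K ∧ u ≤ τ) ∨ 3 ≤ K) ∧
      K * Nat.fib (M + 1) * u ≤ Nat.fib (M + 1) - sternSeq b x := by
    -- For `b = 2`, `u ≤ τ` follows from `log 2 < 1`; for `b ≥ 3`, `κ = 1/3` already gives `b²/3 ≥
    -- 3`.
    rcases hb.eq_or_lt with rfl | hb3
    · refine ⟨_, Or.inl ⟨?_, ?_⟩, defect (11 / 20) ?_⟩
      · norm_num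
      · have h1 := Real.add_one_le_exp (Real.log 2 * -τ)
        rw [← Real.rpow_def_of_pos (by norm_num)] at h1
        push_cast at hbτ
        rw [hbτ] at h1
        have := Real.log_two_lt_d9
        have : Real.log 2 * τ ≤ 1 * τ := by gcongr; linarith
        linarith
      · rw [hD]
        exact_mod_cast fib_sub_sternSeq_two_lower M hx.le
    · refine ⟨_, Or.inr ?_, defect (1 / 3) (fib_sub_sternSeq_lower_third hb M hx.le)⟩
      have : (3 : ℝ) ≤ b := by exact_mod_cast hb3
      nlinarith
  obtain ⟨K, hK, hL⟩ := hKL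
  obtain ⟨r1, r2⟩ := goldenCosh_gt_of_defect hbR (by omega : 3 ≤ M + 1) hτ0 hu0 hu4 hbτ hK hL
  rw [show M + 1 + 2 = M + 3 by ring, ← hτ] at r1 r2
  rw [show M + 1 + 4 = M + 5 by ring] at r2
  have s5 : 0 ≤ √(5 : ℝ) := by positivity
  have hs' := mul_le_mul_of_nonneg_left hs s5
  have ht' := mul_le_mul_of_nonneg_left ht s5
  rw [show ((M + 3 : ℕ) : ℝ) - β = τ by rw [hτ]; ring]
  rw [f1] at r1
  rw [f3, f2, f1] at r2
  constructor <;> linarith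

theorem sternBounds_of_hSeq_lt {b : ℕ} (hb : 2 ≤ b) {M x : ℕ} (hM : 1 ≤ M)
    (hx : hSeq b (M + 1) < x) (hxM : x ≤ hSeq b (M + 2)) : SternBounds b (M + 2) x := by
  rcases Nat.lt_or_ge (b ^ M) x with hlt | hle
  · rcases hxM.eq_or_lt with rfl | hxM
    · exact sternBounds_hSeq hb hM
    obtain ⟨y, rfl⟩ : ∃ y, x = b ^ M + y := ⟨x - b ^ M, by omega⟩
    rw [hSeq_add_two b hM] at hxM
    -- For `M = 1, 2` the range `1 ≤ y < h_M = 1` is empty.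
    rcases (by omega : M = 1 ∨ M = 2 ∨ 3 ≤ M) with rfl | rfl | h3
    · simp [hSeq] at hxM; omega
    · simp [hSeq] at hxM; omega
    · obtain ⟨N, rfl⟩ : ∃ N, M = N + 1 := ⟨M - 1, by omega⟩
      exact sternBounds_of_lt_hSeq hb (by omega) (by omega) (by omega)
  · exact sternBounds_of_le_pow hb hM hx hle

/-- The new second inequality is the sum of the two old ones. -/
theorem SternBounds.succ {b m x : ℕ} (hb : 2 ≤ b) (hx : x ≤ b ^ m) (h : SternBounds b m x) :
    SternBounds b (m + 1) x := by
  refine ⟨h.1, ?_⟩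
  have h1 := h.1
  have h2 := h.2
  rw [sternSeq_pow_succ_add hb m x hx]
  push_cast
  linarith

theorem sternBounds_one {b : ℕ} (hb : 2 ≤ b) : SternBounds b 2 1 := by
  have hbR : (2 : ℝ) ≤ b := by exact_mod_cast hb
  have hβ : betaFun b ((1 : ℕ) : ℝ) = ((2 : ℕ) : ℝ) := by
    have hy := base_rpow_betaFun hb (x := ((1 : ℕ) : ℝ)) (by simp)
    rw [← Real.rpow_right_inj (by linarith : (0 : ℝ) < b) (by linarith), hy, Real.rpow_natCast]
    push_cast; ring
  have h1 : sternSeq b (b ^ 2 + 1) = 3 := by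
    have := sternSeq_pow_succ_add hb 1 1 (by simp; omega)
    simpa [sternSeq_base_add_one hb, sternSeq_one] using this
  -- Since `β(1) = 2`, `s(1) = F_2` and `s(b² + 1) = 3 = F_4`, both bounds are the strict even-index
  -- case.
  have f1 := sqrt_five_mul_fib_lt_of_even (m := 2) (by decide)
  have f2 := sqrt_five_mul_fib_lt_of_even (m := 4) (by decide)
  unfold SternBounds
  rw [hβ, h1, sternSeq_one]
  norm_num [Nat.fib_add_two] at f1 f2 ⊢
  exact ⟨f1, f2⟩

theorem sternBounds_of_le_hSeq {b : ℕ} (hb : 2 ≤ b) (k : ℕ) {x : ℕ} (hx1 : 1 ≤ x)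
    (hx : x ≤ hSeq b (k + 2)) : SternBounds b (k + 2) x := by
  induction k with
  | zero =>
    obtain rfl : x = 1 := by simp [hSeq] at hx; omega
    exact sternBounds_one hb
  | succ k ih =>
    rcases Nat.lt_or_ge (hSeq b (k + 2)) x with hlt | hle
    · exact sternBounds_of_hSeq_lt hb (by omega) hlt hx
    · exact (ih hle).succ hb ((hle.trans (hSeq_le_pow hb (k + 1))).trans
        (Nat.pow_le_pow_right (by omega) (by omega)))

theorem mainTheorem6 (b : ℕ) (hb : 2 ≤ b) (k n : ℕ) (hk : 3 ≤ k)
    (hn_lower : b ^ k < n) (hn_upper : n ≤ b ^ k + hSeq b k) :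
    (sternSeq b n : ℝ) < fFun b k ((n : ℝ) - (b : ℝ) ^ k) := by
  obtain ⟨x, rfl⟩ : ∃ x, n = b ^ k + x := ⟨n - b ^ k, by omega⟩
  obtain ⟨j, rfl⟩ : ∃ j, k = j + 2 := ⟨k - 2, by omega⟩
  have h := (sternBounds_of_le_hSeq hb j (x := x) (by omega) (by omega)).2
  rw [← sqrt_five_mul_fFun] at h
  have := lt_of_mul_lt_mul_left h (by positivity)
  push_cast
  rwa [add_sub_cancel_left]
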